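/- \textbf{Setting.} Consider finitely many variables: a treatment $T$, a real-valued outcome $Y$, and covariates $X=(X_i)_{i\in I}$, where $T$ and the $X_i$ take values in standard Borel spaces. A \emph{causal model} on $(X,T,Y)$ consists of a directed acyclic graph $\mathcal G$ on these variables, a causal mechanism for every variable $V$ (a Markov kernel $\kappa_V$ from the values of its parents $\mathrm{Pa}(V)$ to the values of $V$), and a joint distribution $P$ of $(X,T,Y)$ that respects them: the conditional law of each variable $V$ given all its non-descendants is $\kappa_V(\mathrm{Pa}(V),\cdot)$. Fix a causal model $(\mathcal G,P)$, and let $\mathrm{Pa}(Y)$ denote the parents of $Y$ in $\mathcal G$. Assume that $\kappa_Y(a,\cdot)$ has a finite mean for every value $a$ of $\mathrm{Pa}(Y)$, and write $\mathbb E[Y\mid \mathrm{Pa}(Y)=a]=\int y\,\kappa_Y(a,dy)$ for the version of the conditional expectation given by the mechanism. An \emph{intervention} on a set $S$ of variables replaces the mechanisms of the variables in $S$ by new ones (constant for an atomic intervention, random for a stochastic one), possibly with new parents, and leaves the parents and mechanisms of all other variables unchanged, so that the resulting graph $\mathcal G_e$ is acyclic. The result is a causal model $e$ with distribution $P^e=P(X^e,T^e,Y^e)$.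 It is a \emph{valid environment} if $Y^e$ is $P^e$-integrable, (i) $\mathbb E_{P^e}[Y^e\mid \mathrm{Pa}(Y)]=\mathbb E[Y\mid \mathrm{Pa}(Y)]$ $P^e$-almost surely, i.e. the left side equals the function $a\mapsto\mathbb E[Y\mid\mathrm{Pa}(Y)=a]$ evaluated at the values of the variables $\mathrm{Pa}(Y)$ in $e$, and (ii) the conditional variance of $Y^e$ given $\mathrm{Pa}(Y)$ is finite $P^e$-almost surely. A \emph{representation} is a measurable map $\Phi$ from the values of $(T,X)$ to a measurable space. It is \emph{invariant across all valid environments} if for any two valid environments $e_1,e_2$ the functions $\pi\mapsto\mathbb E[Y^{e_1}\mid\Phi(T^{e_1},X^{e_1})=\pi]$ and $\pi\mapsto\mathbb E[Y^{e_2}\mid\Phi(T^{e_2},X^{e_2})=\pi]$ are equal. As each is defined only up to null sets of the law of $\Phi$ in its own environment, this means that they have a common measurable version. \textbf{Lemma.} Suppose that $\mathbb E[Y\mid \mathrm{Pa}(Y)=a]\neq\mathbb E[Y\mid \mathrm{Pa}(Y)=a']$ whenever $a\neq a'$. Then a representation $\Phi$ is invariant across all valid environments if and only if, for every valid environment $e$,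 $$\mathbb E[Y^e\mid\Phi(T^e,X^e)]=\mathbb E[Y\mid \mathrm{Pa}(Y)]\qquad P^e\text{-almost surely},$$ where the right side is $a\mapsto\mathbb E[Y\mid\mathrm{Pa}(Y)=a]$ evaluated at the values of $\mathrm{Pa}(Y)$ in $e$. -/

import Mathlib

open MeasureTheory ProbabilityTheory
open scoped ENNReal

noncomputable section

/-- The variables: a treatment `T`, an outcome `Y`, and covariates `X = (X_i)`, `i : ι`. -/
inductive Node (ι : Type) : Type
  | treatment : Node ι
  | outcome : Node ι
  | covariate (i : ι) : Node ι

/-- The value space of each variable; the outcome is real valued. -/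
abbrev Node.Val {ι : Type} (𝒯 : Type) (𝒳 : ι → Type) : Node ι → Type
  | .treatment => 𝒯
  | .outcome => ℝ
  | .covariate i => 𝒳 i

instance Node.instMeasurableSpaceVal {ι : Type} (𝒯 : Type) (𝒳 : ι → Type)
    [MeasurableSpace 𝒯] [∀ i, MeasurableSpace (𝒳 i)] :
    ∀ v : Node ι, MeasurableSpace (Node.Val 𝒯 𝒳 v)
  | .treatment => inferInstanceAs (MeasurableSpace 𝒯)
  | .outcome => inferInstanceAs (MeasurableSpace ℝ)
  | .covariate i => inferInstanceAs (MeasurableSpace (𝒳 i))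

/-- The parents of a node of a directed graph. -/
def parentsOf {V : Type} (G : Digraph V) (v : V) : Set V :=
  {u | G.Adj u v}

/-- The non-descendants of a node (the node itself counts as one of its descendants). -/
def nonDescendantsOf {V : Type} (G : Digraph V) (v : V) : Set V :=
  {u | ¬ Relation.ReflTransGen G.Adj v u}

/-- A causal model on `(X, T, Y)`: a directed acyclic graph, for every variable a causal mechanism
(a Markov kernel from the values of its parents), and the joint distribution that respects the
graph and is generated by these mechanisms: the conditional law of each variable given all its
non-descendants is its mechanism evaluated at its parents. -/
structure CausalModel {ι : Type} (𝒯 : Type) (𝒳 : ι → Type)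
    [MeasurableSpace 𝒯] [∀ i, MeasurableSpace (𝒳 i)] where
  graph : Digraph (Node ι)
  acyclic : ∀ v, ¬ Relation.TransGen graph.Adj v v
  mech : ∀ v, Kernel (∀ u : parentsOf graph v, Node.Val 𝒯 𝒳 u) (Node.Val 𝒯 𝒳 v)
  isMarkovKernel_mech : ∀ v, IsMarkovKernel (mech v)
  law : Measure (∀ v, Node.Val 𝒯 𝒳 v)
  isProbabilityMeasure_law : IsProbabilityMeasure law
  law_respects : ∀ (v : Node ι) (A : Set (∀ u : nonDescendantsOf graph v, Node.Val 𝒯 𝒳 u))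
    (B : Set (Node.Val 𝒯 𝒳 v)), MeasurableSet A → MeasurableSet B →
    law {x | (nonDescendantsOf graph v).domRestrict x ∈ A ∧ x v ∈ B} =
      ∫⁻ x in {x | (nonDescendantsOf graph v).domRestrict x ∈ A},
        mech v ((parentsOf graph v).domRestrict x) B ∂law

namespace CausalModel

variable {ι : Type} {𝒯 : Type} {𝒳 : ι → Type}
  [MeasurableSpace 𝒯] [∀ i, MeasurableSpace (𝒳 i)]

instance (M : CausalModel 𝒯 𝒳) (v : Node ι) : IsMarkovKernel (M.mech v) :=
  M.isMarkovKernel_mech v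

instance (M : CausalModel 𝒯 𝒳) : IsProbabilityMeasure M.law :=
  M.isProbabilityMeasure_law

/-- The outcome `Y`, as a random variable. -/
def outcome (x : ∀ v, Node.Val 𝒯 𝒳 v) : ℝ :=
  x .outcome

/-- The treatment and covariates `(T, X)`, as a random variable. -/
def treatmentCovariates (x : ∀ v, Node.Val 𝒯 𝒳 v) : 𝒯 × (∀ i, 𝒳 i) :=
  (x .treatment, fun i => x (.covariate i))

/-- The possible values of the causal parents `Pa(Y)` of the outcome in the graph of `M`. -/
abbrev ParentValues (M : CausalModel 𝒯 𝒳) : Type :=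
  ∀ u : parentsOf M.graph .outcome, Node.Val 𝒯 𝒳 u

/-- The causal parents `Pa(Y)` of the outcome in the graph of `M`, as a random variable. -/
def outcomeParents (M : CausalModel 𝒯 𝒳) (x : ∀ v, Node.Val 𝒯 𝒳 v) : M.ParentValues :=
  (parentsOf M.graph .outcome).domRestrict x

/-- The causal mechanism of `Y` in the model `M`: `M.outcomeLaw a` is the law of `Y` given
`Pa(Y) = a`. -/
def outcomeLaw (M : CausalModel 𝒯 𝒳) : Kernel M.ParentValues ℝ :=
  M.mech .outcome

instance (M : CausalModel 𝒯 𝒳) : IsMarkovKernel M.outcomeLaw :=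
  M.isMarkovKernel_mech .outcome

/-- `E[Y | Pa(Y) = a]` in the model `M`. Of the versions of this conditional expectation, which
differ on null sets, it is the one given by the causal mechanism of `Y`; it makes sense also at
values `a` that only an intervention can produce. -/
def outcomeMean (M : CausalModel 𝒯 𝒳) (a : M.ParentValues) : ℝ :=
  ∫ y, y ∂(M.outcomeLaw a)

/-- `N` results from `M` by an intervention on the variables in `S`. The mechanisms of these
variables are replaced by new ones, which may be constant (atomic intervention) or random
(stochastic intervention), with a new set of parents; all other variables keep their parents and
their mechanisms. The graph of `N` is acyclic, and the law of `N` is the induced distribution. -/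
def IsInterventionOn (N M : CausalModel 𝒯 𝒳) (S : Set (Node ι)) : Prop :=
  ∀ v ∉ S, parentsOf N.graph v = parentsOf M.graph v ∧
    ∀ x : ∀ w, Node.Val 𝒯 𝒳 w,
      N.mech v ((parentsOf N.graph v).domRestrict x) = M.mech v ((parentsOf M.graph v).domRestrict x)

/-- The valid environments of `M`: the models `N` that an intervention creates from `M`, in which
`Y` has an expectation, (i) `E[Y^e | Pa(Y)] = E[Y | Pa(Y)]`, and (ii) the conditional variance
`V(Y^e | Pa(Y))` is finite. Here `Pa(Y)` are the parents in the graph of `M`. -/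
def validEnvironments (M : CausalModel 𝒯 𝒳) : Set (CausalModel 𝒯 𝒳) :=
  {N | (∃ S, N.IsInterventionOn M S) ∧
    Integrable outcome N.law ∧
    N.law[outcome | MeasurableSpace.comap M.outcomeParents inferInstance]
      =ᵐ[N.law] (fun x => M.outcomeMean (M.outcomeParents x)) ∧
    ∀ᵐ a ∂(N.law.map M.outcomeParents),
      evariance (fun y : ℝ => y) (condDistrib outcome M.outcomeParents N.law a) < ∞}

/-- The random variable `E[Y^e | Φ(T^e, X^e)]` in the environment `N`. -/
def condExpGiven {H : Type*} [MeasurableSpace H] (N : CausalModel 𝒯 𝒳)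
    (Φ : 𝒯 × (∀ i, 𝒳 i) → H) : (∀ v, Node.Val 𝒯 𝒳 v) → ℝ :=
  N.law[outcome |
    MeasurableSpace.comap (fun x : ∀ v, Node.Val 𝒯 𝒳 v => Φ (treatmentCovariates x)) inferInstance]

/-- `g` is (a version of) the function `π ↦ E[Y^e | Φ(T^e, X^e) = π]` in the environment `N`. -/
def IsRegressionFunction {H : Type*} [MeasurableSpace H] (N : CausalModel 𝒯 𝒳)
    (Φ : 𝒯 × (∀ i, 𝒳 i) → H) (g : H → ℝ) : Prop :=
  Measurable g ∧ N.condExpGiven Φ =ᵐ[N.law] fun x => g (Φ (treatmentCovariates x))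

/-- `Φ` is invariant with respect to the environments `ℰ`: for any two of them, the functions
`π ↦ E[Y^{e₁} | Φ(T^{e₁}, X^{e₁}) = π]` and `π ↦ E[Y^{e₂} | Φ(T^{e₂}, X^{e₂}) = π]` are equal.
Each is determined up to null sets of the law of `Φ` in its own environment, so equality means
that some function is a version of both. -/
def IsInvariant {H : Type*} [MeasurableSpace H] (Φ : 𝒯 × (∀ i, 𝒳 i) → H)
    (ℰ : Set (CausalModel 𝒯 𝒳)) : Prop :=
  ∀ e₁ ∈ ℰ, ∀ e₂ ∈ ℰ, ∃ g : H → ℝ, e₁.IsRegressionFunction Φ g ∧ e₂.IsRegressionFunction Φ g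

end CausalModel

end

namespace CausalModel

variable {ι : Type} {𝒯 : Type} {𝒳 : ι → Type}
  [MeasurableSpace 𝒯] [∀ i, MeasurableSpace (𝒳 i)]

/-! Write m(a) for the mean of the mechanism of Y at a. Intervening on all variables produces any
joint law, so every law with Y integrable and Y = m(Pa(Y)) almost surely is valid
(`exists_validEnvironment_law_eq`). Such laws are closed under conditioning on events and under
mixing. If Φ is invariant, conditioning such a law on arbitrary events A forces E[Y | Φ] = Y
(`IsInvariant.ae_eq_outcome`). A general valid e is compared with its copy in which Y is set to
m(Pa(Y)): a common version g satisfies g(Φ) = m(Pa(Y)) in the copy, and hence in e, since neither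
side involves Y. Conversely, the regression function of the mixture of two such copies serves both
environments. -/

theorem standardBorelSpace_val [StandardBorelSpace 𝒯] [∀ i, StandardBorelSpace (𝒳 i)] :
    ∀ v : Node ι, StandardBorelSpace (Node.Val 𝒯 𝒳 v)
  | .treatment => inferInstanceAs (StandardBorelSpace 𝒯)
  | .outcome => inferInstanceAs (StandardBorelSpace ℝ)
  | .covariate i => inferInstanceAs (StandardBorelSpace (𝒳 i))

instance [Finite ι] : Finite (Node ι) :=
  Finite.of_injective
    (fun v : Node ι => match v with
      | .treatment => some none
      | .outcome => none
      | .covariate i => some (some i))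
    (by rintro (_ | _ | i) (_ | _ | j) h <;> simp_all)

theorem measurable_outcome : Measurable (outcome (𝒯 := 𝒯) (𝒳 := 𝒳)) :=
  measurable_pi_apply (Node.outcome : Node ι)

theorem measurable_treatmentCovariates :
    Measurable (treatmentCovariates (𝒯 := 𝒯) (𝒳 := 𝒳)) :=
  Measurable.prodMk (measurable_pi_apply (Node.treatment : Node ι))
    (measurable_pi_iff.2 fun i => measurable_pi_apply (Node.covariate i : Node ι))

theorem measurable_domRestrict (s : Set (Node ι)) :
    Measurable (s.domRestrict : (∀ v, Node.Val 𝒯 𝒳 v) → ∀ u : s, Node.Val 𝒯 𝒳 u) :=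
  measurable_pi_iff.2 fun u => measurable_pi_apply (u : Node ι)

theorem measurable_outcomeParents (M : CausalModel 𝒯 𝒳) : Measurable M.outcomeParents :=
  measurable_domRestrict _

theorem measurable_outcomeMean (M : CausalModel 𝒯 𝒳) : Measurable M.outcomeMean :=
  (StronglyMeasurable.integral_kernel (κ := M.outcomeLaw) stronglyMeasurable_id).measurable

/-! ### Realising laws by causal models and valid environments -/

/-- The mechanism at `v` obtained by disintegration satisfies the defining identity of a causal
model whenever the parents and the non-descendants coincide. -/
theorem measure_inter_eq_setLIntegral_condDistrib (P : Measure (∀ v, Node.Val 𝒯 𝒳 v))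
    [IsProbabilityMeasure P] (v : Node ι) [StandardBorelSpace (Node.Val 𝒯 𝒳 v)]
    [Nonempty (Node.Val 𝒯 𝒳 v)] {s t : Set (Node ι)} (h : s = t)
    {A : Set (∀ u : s, Node.Val 𝒯 𝒳 u)} {B : Set (Node.Val 𝒯 𝒳 v)}
    (hA : MeasurableSet A) (hB : MeasurableSet B) :
    P {x | s.domRestrict x ∈ A ∧ x v ∈ B} =
      ∫⁻ x in {x | s.domRestrict x ∈ A},
        condDistrib (fun x : ∀ v, Node.Val 𝒯 𝒳 v => x v) t.domRestrict P (t.domRestrict x) B ∂P := by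
  subst h
  exact (setLIntegral_preimage_condDistrib (measurable_domRestrict s)
    (measurable_pi_apply v).aemeasurable hB hA).symm

/-- Every probability measure is the law of a causal model, on a complete acyclic graph. -/
theorem exists_law_eq [Finite ι] [StandardBorelSpace 𝒯] [∀ i, StandardBorelSpace (𝒳 i)]
    (P : Measure (∀ v, Node.Val 𝒯 𝒳 v)) [IsProbabilityMeasure P] :
    ∃ N : CausalModel 𝒯 𝒳, N.law = P := by
  obtain ⟨f, hf⟩ := exists_injective_nat (Node ι)
  obtain ⟨x₀⟩ := nonempty_of_isProbabilityMeasure P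
  have hne : ∀ v, Nonempty (Node.Val 𝒯 𝒳 v) := fun v => ⟨x₀ v⟩
  have hsb := standardBorelSpace_val (𝒯 := 𝒯) (𝒳 := 𝒳)
  -- Along a total order the non-descendants of a node are exactly its parents, so the Markov
  -- property is mere disintegration.
  let G : Digraph (Node ι) := { Adj := fun u v => f u < f v }
  have hG : ∀ {u v}, Relation.TransGen G.Adj u v → f u < f v := fun h => by
    induction h with
    | single h => exact h
    | tail _ h ih => exact ih.trans h
  have hnd : ∀ v, nonDescendantsOf G v = parentsOf G v := by
    intro v
    ext u
    change ¬ Relation.ReflTransGen G.Adj v u ↔ f u < f v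
    rw [Relation.reflTransGen_iff_eq_or_transGen]
    constructor
    · intro h
      push Not at h
      refine lt_of_le_of_ne (not_lt.1 fun hlt => h.2 (.single hlt)) fun he => h.1 (hf he)
    · rintro h (rfl | h')
      · exact lt_irrefl _ h
      · exact lt_asymm h (hG h')
  exact ⟨{
    graph := G
    acyclic := fun v h => lt_irrefl _ (hG h)
    mech := fun v => condDistrib (fun x : ∀ v, Node.Val 𝒯 𝒳 v => x v) (parentsOf G v).domRestrict P
    isMarkovKernel_mech := fun v => inferInstance
    law := P
    isProbabilityMeasure_law := inferInstance
    law_respects := fun v A B hA hB =>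
      measure_inter_eq_setLIntegral_condDistrib P v (hnd v) hA hB }, rfl⟩

/-- A law under which the outcome is the conditional mean of the model, evaluated at the parents,
is the law of a valid environment. -/
theorem exists_validEnvironment_law_eq [Finite ι] [StandardBorelSpace 𝒯]
    [∀ i, StandardBorelSpace (𝒳 i)] (M : CausalModel 𝒯 𝒳)
    (P : Measure (∀ v, Node.Val 𝒯 𝒳 v)) [IsProbabilityMeasure P] (hint : Integrable outcome P)
    (hY : outcome =ᵐ[P] fun x => M.outcomeMean (M.outcomeParents x)) :
    ∃ N ∈ M.validEnvironments, N.law = P := by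
  obtain ⟨N, rfl⟩ := exists_law_eq P
  refine ⟨N, ⟨⟨Set.univ, fun v hv => absurd (Set.mem_univ v) hv⟩, hint, ?_, ?_⟩, rfl⟩
  · refine (condExp_congr_ae hY).trans (Filter.EventuallyEq.of_eq ?_)
    refine condExp_of_stronglyMeasurable M.measurable_outcomeParents.comap_le ?_
      (hint.congr hY)
    exact (M.measurable_outcomeMean.comp (comap_measurable _)).stronglyMeasurable
  -- The conditional law of the outcome is a Dirac mass, of variance zero.
  · have hc : condDistrib outcome M.outcomeParents N.law =ᵐ[N.law.map M.outcomeParents]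
        Kernel.deterministic M.outcomeMean M.measurable_outcomeMean := by
      rw [condDistrib_congr_left hY]
      exact condDistrib_comp_self M.outcomeParents M.measurable_outcomeMean
    filter_upwards [hc] with a ha
    rw [ha, Kernel.deterministic_apply]
    simp [evariance]

/-! ### Setting the outcome to its conditional mean -/

open Classical in
/-- Replace the outcome by its conditional mean given the parents of the outcome in `M`. -/
noncomputable def setOutcomeToMean (M : CausalModel 𝒯 𝒳) (x : ∀ v, Node.Val 𝒯 𝒳 v) :
    ∀ v, Node.Val 𝒯 𝒳 v :=
  Function.update x .outcome (M.outcomeMean (M.outcomeParents x))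

theorem outcome_setOutcomeToMean (M : CausalModel 𝒯 𝒳) (x : ∀ v, Node.Val 𝒯 𝒳 v) :
    outcome (M.setOutcomeToMean x) = M.outcomeMean (M.outcomeParents x) := by
  simp [outcome, setOutcomeToMean]

/-- By acyclicity the outcome is not its own parent. -/
theorem outcomeParents_setOutcomeToMean (M : CausalModel 𝒯 𝒳) (x : ∀ v, Node.Val 𝒯 𝒳 v) :
    M.outcomeParents (M.setOutcomeToMean x) = M.outcomeParents x := by
  funext u
  have hu : (u : Node ι) ≠ .outcome := fun h => by
    have hadj : M.graph.Adj u .outcome := u.2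
    rw [h] at hadj
    exact M.acyclic _ (.single hadj)
  classical
  exact Function.update_of_ne hu _ _

theorem treatmentCovariates_setOutcomeToMean (M : CausalModel 𝒯 𝒳)
    (x : ∀ v, Node.Val 𝒯 𝒳 v) :
    treatmentCovariates (M.setOutcomeToMean x) = treatmentCovariates x := by
  simp [treatmentCovariates, setOutcomeToMean]

theorem measurable_setOutcomeToMean (M : CausalModel 𝒯 𝒳) : Measurable M.setOutcomeToMean := by
  refine measurable_pi_iff.2 fun v => ?_
  by_cases hv : v = .outcome
  · subst hv
    have : (fun x => M.setOutcomeToMean x .outcome) =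
        fun x => M.outcomeMean (M.outcomeParents x) := funext M.outcome_setOutcomeToMean
    rw [this]
    exact M.measurable_outcomeMean.comp M.measurable_outcomeParents
  · have : (fun x => M.setOutcomeToMean x v) = fun x => x v :=
      funext fun x => by classical exact Function.update_of_ne hv _ _
    rw [this]
    exact measurable_pi_apply v

/-- The law of an environment in which the outcome has been set to its conditional mean. -/
noncomputable def meanLaw (M e : CausalModel 𝒯 𝒳) : Measure (∀ v, Node.Val 𝒯 𝒳 v) :=
  e.law.map M.setOutcomeToMean

instance (M e : CausalModel 𝒯 𝒳) : IsProbabilityMeasure (M.meanLaw e) :=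
  Measure.isProbabilityMeasure_map M.measurable_setOutcomeToMean.aemeasurable

theorem outcome_ae_eq_meanLaw (M e : CausalModel 𝒯 𝒳) :
    outcome =ᵐ[M.meanLaw e] fun x => M.outcomeMean (M.outcomeParents x) := by
  refine (ae_map_iff M.measurable_setOutcomeToMean.aemeasurable (measurableSet_eq_fun
    measurable_outcome (M.measurable_outcomeMean.comp M.measurable_outcomeParents))).2
    (Filter.Eventually.of_forall fun x => ?_)
  rw [outcome_setOutcomeToMean, Function.comp_apply, outcomeParents_setOutcomeToMean]

theorem integrable_outcome_meanLaw {M e : CausalModel 𝒯 𝒳} (he : e ∈ M.validEnvironments) :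
    Integrable outcome (M.meanLaw e) := by
  refine (integrable_map_measure measurable_outcome.aestronglyMeasurable
    M.measurable_setOutcomeToMean.aemeasurable).2 ?_
  -- By validity condition (i), the mean at the parents is a conditional expectation under `e.law`,
  -- hence integrable.
  refine (integrable_condExp.congr he.2.2.1).congr (Filter.Eventually.of_forall fun x => ?_)
  exact (M.outcome_setOutcomeToMean x).symm

/-- A function of the representation equal to the outcome almost surely under the law with the
outcome set to its mean is equal to that mean in the original environment. -/
theorem ae_eq_outcomeMean_of_meanLaw {H : Type*} {Φ : 𝒯 × (∀ i, 𝒳 i) → H}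
    {M e : CausalModel 𝒯 𝒳} {g : H → ℝ}
    (h : (fun x => g (Φ (treatmentCovariates x))) =ᵐ[M.meanLaw e] outcome) :
    (fun x => g (Φ (treatmentCovariates x))) =ᵐ[e.law]
      fun x => M.outcomeMean (M.outcomeParents x) := by
  filter_upwards [ae_of_ae_map M.measurable_setOutcomeToMean.aemeasurable h] with x hx
  rwa [treatmentCovariates_setOutcomeToMean, outcome_setOutcomeToMean] at hx

/-! ### Regression on the representation -/

section Representation

variable {H : Type*} [MeasurableSpace H] {Φ : 𝒯 × (∀ i, 𝒳 i) → H}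

/-- Doob–Dynkin factorisation through Φ. -/
theorem exists_isRegressionFunction (N : CausalModel 𝒯 𝒳) (Φ : 𝒯 × (∀ i, 𝒳 i) → H) :
    ∃ g, N.IsRegressionFunction Φ g := by
  obtain ⟨g, hg, he⟩ := Measurable.exists_eq_measurable_comp
    (f := fun x : ∀ v, Node.Val 𝒯 𝒳 v => Φ (treatmentCovariates x))
    (stronglyMeasurable_condExp (μ := N.law) (f := outcome)).measurable
  exact ⟨g, hg, Filter.EventuallyEq.of_eq he⟩

theorem IsRegressionFunction.integral_eq {N : CausalModel 𝒯 𝒳} (hΦ : Measurable Φ) {g : H → ℝ}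
    (h : N.IsRegressionFunction Φ g) :
    ∫ x, g (Φ (treatmentCovariates x)) ∂N.law = ∫ x, outcome x ∂N.law := by
  rw [← integral_congr_ae h.2]
  exact integral_condExp (hΦ.comp measurable_treatmentCovariates).comap_le

/-- If `Φ` is invariant and the outcome of `N` is its mean given the parents, then the outcome is
a function of `Φ`. -/
theorem IsInvariant.ae_eq_outcome [Finite ι] [StandardBorelSpace 𝒯]
    [∀ i, StandardBorelSpace (𝒳 i)] {M N : CausalModel 𝒯 𝒳} (hΦ : Measurable Φ)
    (hinv : IsInvariant Φ M.validEnvironments) (hN : N ∈ M.validEnvironments)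
    (hY : outcome =ᵐ[N.law] fun x => M.outcomeMean (M.outcomeParents x)) :
    N.condExpGiven Φ =ᵐ[N.law] outcome := by
  have hint : Integrable outcome N.law := hN.2.1
  -- Here `A` is any event, not only one generated by Φ; this is what gives the outcome itself.
  refine Integrable.ae_eq_of_forall_setIntegral_eq _ _ integrable_condExp hint fun A hA _ => ?_
  by_cases h0 : N.law A = 0
  · simp [Measure.restrict_eq_zero.2 h0]
  have := cond_isProbabilityMeasure (μ := N.law) h0
  have hfin : (N.law A)⁻¹ ≠ ∞ := ENNReal.inv_ne_top.2 h0
  obtain ⟨N', hN', hlaw⟩ := M.exists_validEnvironment_law_eq (N.law[|A])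
    (hint.integrableOn.smul_measure hfin) (cond_absolutelyContinuous.ae_eq hY)
  obtain ⟨g, hg, hg'⟩ := hinv N hN N' hN'
  -- The tower property in the environment conditioned on `A`; the factor 1/P(A) then cancels.
  have key := hg'.integral_eq hΦ
  rw [hlaw, ProbabilityTheory.cond, integral_smul_measure, integral_smul_measure] at key
  have hne : (N.law A)⁻¹.toReal ≠ 0 :=
    ENNReal.toReal_ne_zero.2 ⟨ENNReal.inv_ne_zero.2 (measure_ne_top _ _), hfin⟩
  rw [← smul_right_injective ℝ hne key]
  exact integral_congr_ae (ae_restrict_of_ae hg.2)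

end Representation

end CausalModel

theorem mainTheorem2 {ι : Type} [Finite ι] {𝒯 : Type} {𝒳 : ι → Type}
    [MeasurableSpace 𝒯] [StandardBorelSpace 𝒯]
    [∀ i, MeasurableSpace (𝒳 i)] [∀ i, StandardBorelSpace (𝒳 i)]
    {H : Type*} [MeasurableSpace H]
    (M : CausalModel 𝒯 𝒳)
    (hmean : ∀ a : M.ParentValues, Integrable (fun y : ℝ => y) (M.outcomeLaw a))
    (hinj : ∀ a a' : M.ParentValues, a ≠ a' → M.outcomeMean a ≠ M.outcomeMean a')
    (Φ : 𝒯 × (∀ i, 𝒳 i) → H) (hΦ : Measurable Φ) :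
    CausalModel.IsInvariant Φ M.validEnvironments ↔
      ∀ e ∈ M.validEnvironments,
        e.condExpGiven Φ =ᵐ[e.law] fun x => M.outcomeMean (M.outcomeParents x) := by
  constructor
  · intro hinv e he
    have hY := M.outcome_ae_eq_meanLaw e
    obtain ⟨N, hN, hlaw⟩ := M.exists_validEnvironment_law_eq (M.meanLaw e)
      (CausalModel.integrable_outcome_meanLaw he) hY
    obtain ⟨g, hge, hgN⟩ := hinv e he N hN
    have h := hgN.2.symm.trans (hinv.ae_eq_outcome hΦ hN (hlaw ▸ hY))
    rw [hlaw] at h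
    exact hge.2.trans (CausalModel.ae_eq_outcomeMean_of_meanLaw h)
  · intro h e₁ he₁ e₂ he₂
    -- Both mean laws are absolutely continuous with respect to their mixture, so an almost sure
    -- identity under `Q` holds under each.
    let Q := (2⁻¹ : ℝ≥0∞) • (M.meanLaw e₁ + M.meanLaw e₂)
    have hQ : IsProbabilityMeasure Q := ⟨by
      simp [Q, ENNReal.inv_two_add_inv_two]⟩
    have hac : M.meanLaw e₁ + M.meanLaw e₂ ≪ Q :=
      Measure.absolutelyContinuous_smul (by simp)
    have hY : CausalModel.outcome =ᵐ[Q] fun x => M.outcomeMean (M.outcomeParents x) :=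
      Measure.smul_absolutelyContinuous.ae_eq (ae_add_measure_iff.2
        ⟨M.outcome_ae_eq_meanLaw e₁, M.outcome_ae_eq_meanLaw e₂⟩)
    obtain ⟨N, hN, hlaw⟩ := M.exists_validEnvironment_law_eq Q
      (((CausalModel.integrable_outcome_meanLaw he₁).add_measure
        (CausalModel.integrable_outcome_meanLaw he₂)).smul_measure (by simp)) hY
    obtain ⟨g, hg⟩ := N.exists_isRegressionFunction Φ
    have hgY := hg.2.symm.trans (h N hN)
    rw [hlaw] at hgY
    obtain ⟨h₁, h₂⟩ := ae_add_measure_iff.1 (hac.ae_eq (hgY.trans hY.symm))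
    exact ⟨g,
      ⟨hg.1, (h e₁ he₁).trans (CausalModel.ae_eq_outcomeMean_of_meanLaw h₁).symm⟩,
      ⟨hg.1, (h e₂ he₂).trans (CausalModel.ae_eq_outcomeMean_of_meanLaw h₂).symm⟩⟩
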